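/- Let $(R,\mathfrak m,k)$ be a Noetherian complete local ring that is Cohen–Macaulay, of Krull dimension $d$. Let $E$ be an injective hull of $k$, write $M^\vee=\operatorname{Hom}_R(M,E)$, and let $\omega$ be a canonical module of $R$, that is, a finitely generated $R$-module with an isomorphism $\omega^\vee\cong H^d_{\mathfrak m}(R)$, which is used to identify the two modules. A closure operation $\mathrm{cl}$ on $R$-modules assigns to each pair $N\subseteq M$ of $R$-modules a submodule $N_M^{\mathrm{cl}}$ of $M$ such that $N\subseteq N_M^{\mathrm{cl}}=(N_M^{\mathrm{cl}})_M^{\mathrm{cl}}$, and $N_M^{\mathrm{cl}}\subseteq (N')_M^{\mathrm{cl}}$ whenever $N\subseteq N'\subseteq M$. It is functorial if $f(L_M^{\mathrm{cl}})\subseteq f(L)_N^{\mathrm{cl}}$ for every $R$-linear map $f:M\to N$ and every $L\subseteq M$. It is residual if $N_M^{\mathrm{cl}}=\pi^{-1}\big((N/L)_{M/L}^{\mathrm{cl}}\big)$ for all $L\subseteq N\subseteq M$, where $\pi:M\to M/L$ is the natural surjection. Its finitistic version is $$L_M^{\mathrm{cl}_{fg}}=\bigcup\{L_N^{\mathrm{cl}}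 : L\subseteq N\subseteq M,\ N/L \text{ finitely generated}\}.$$ An ideal $I$ of $R$ is $\mathrm{cl}$-closed if $I_R^{\mathrm{cl}}=I$. For a submodule $N\subseteq\omega^\vee$ let $\operatorname{Ann}_\omega N=\{f\in\operatorname{Hom}_R(\omega^\vee,E) : f(N)=0\}$, a submodule of $\omega^{\vee\vee}\cong\omega$. The ring $R$ is $\mathrm{cl}$-rational if $\operatorname{Ann}_\omega 0^{\mathrm{cl}}_{H^d_{\mathfrak m}(R)}=\omega$, i.e. if this annihilator is all of $\omega^{\vee\vee}\cong\omega$. Let $\mathrm{cl}$ be a residual, functorial closure operation on $R$-modules. 1. If $R$ is $\mathrm{cl}$-rational, then every ideal of $R$ generated by a (full) system of parameters of $R$ is $\mathrm{cl}$-closed. 2. If in addition $\mathrm{cl}$ satisfies the injective finiteness condition $0^{\mathrm{cl}}_{H^d_{\mathfrak m}(R)}=0^{\mathrm{cl}_{fg}}_{H^d_{\mathfrak m}(R)}$, then the converse holds: if every ideal of $R$ generated by a system of parameters is $\mathrm{cl}$-closed, then $R$ is $\mathrm{cl}$-rational. -/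

import Mathlib

open IsLocalRing

universe u

namespace ClRationality

section Closure

variable (R : Type u) [CommRing R]

/-- A closure operation on (all) `R`-modules: to every submodule `N` of a module `M` it assigns a
submodule `cl N` of `M`, and the assignment is extensive, idempotent and monotone. -/
structure ClosureOperation where
  /-- the closure `N_M^cl` of `N` in `M` -/
  cl : ∀ {M : Type u} [AddCommGroup M] [Module R M], Submodule R M → Submodule R M
  le_cl : ∀ {M : Type u} [AddCommGroup M] [Module R M] (N : Submodule R M), N ≤ cl N
  cl_cl : ∀ {M : Type u} [AddCommGroup M] [Module R M] (N : Submodule R M), cl (cl N) = cl N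
  cl_mono : ∀ {M : Type u} [AddCommGroup M] [Module R M] (N N' : Submodule R M),
    N ≤ N' → cl N ≤ cl N'

namespace ClosureOperation

variable {R}
variable (c : ClosureOperation R)

/-- `f (L_M^cl) ⊆ (f L)_N^cl` for every linear map `f : M → N` and every `L ⊆ M`. -/
def IsFunctorial : Prop :=
  ∀ (M N : Type u) [AddCommGroup M] [Module R M] [AddCommGroup N] [Module R N]
    (f : M →ₗ[R] N) (L : Submodule R M), (c.cl L).map f ≤ c.cl (L.map f)

/-- `N_M^cl = π⁻¹ ((N/L)_{M/L}^cl)` whenever `L ⊆ N ⊆ M`, with `π : M → M/L` the projection;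
the submodule `N/L` of `M/L` is the image of `N` under `π`. -/
def IsResidual : Prop :=
  ∀ (M : Type u) [AddCommGroup M] [Module R M] (L N : Submodule R M), L ≤ N →
    c.cl N = (c.cl (N.map L.mkQ)).comap L.mkQ

/-- The finitistic version: the union of the closures `L_N^cl` of `L` in `N`, over all `N` with
`L ⊆ N ⊆ M` and `N/L` finitely generated. -/
def clFg {M : Type u} [AddCommGroup M] [Module R M] (L : Submodule R M) : Set M :=
  ⋃ (N : Submodule R M) (_ : L ≤ N) (_ : Module.Finite R (↥N ⧸ L.submoduleOf N)),
    ((c.cl (L.submoduleOf N)).map N.subtype : Set M)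

end ClosureOperation

end Closure

section Local

variable (R : Type u) [CommRing R] [IsLocalRing R]

/-- A local ring is Cohen-Macaulay if its maximal ideal contains an `R`-regular sequence of
length the Krull dimension of `R`. -/
def IsCohenMacaulayLocal : Prop :=
  ∃ rs : List R, (∀ r ∈ rs, r ∈ maximalIdeal R) ∧ RingTheory.Sequence.IsRegular R rs ∧
    ((rs.length : ℕ) : WithBot ℕ∞) = ringKrullDim R

/-- `x₁, …, xₙ` is a (full) system of parameters: `n` is the Krull dimension of `R` and the ideal
`(x₁, …, xₙ)` is primary to the maximal ideal. -/
def IsSystemOfParameters {R : Type u} [CommRing R] [IsLocalRing R] {n : ℕ} (x : Fin n → R) :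
    Prop :=
  ringKrullDim R = (n : WithBot ℕ∞) ∧ (Ideal.span (Set.range x)).radical = maximalIdeal R

/-- The `i`-th local cohomology module `H^i_m(R)` of `R` with support in its maximal ideal. -/
noncomputable abbrev LocalCohomologyRing (i : ℕ) : ModuleCat.{u} R :=
  (localCohomology (maximalIdeal R) i).obj (ModuleCat.of R R)

end Local

section Matlis

variable {R : Type u} [CommRing R]

/-- `ι : K → E` is an injective hull: `ι` is injective, `E` is an injective module, and `E` is an
essential extension of the image of `ι`. -/
structure IsInjectiveHull {K E : Type u} [AddCommGroup K] [Module R K] [AddCommGroup E]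
    [Module R E] (ι : K →ₗ[R] E) : Prop where
  injective_map : Function.Injective ι
  injective_module : Module.Injective R E
  essential : ∀ N : Submodule R E, N ⊓ LinearMap.range ι = ⊥ → N = ⊥

/-- The Matlis dual `M^∨ = Hom_R(M, E)`. -/
abbrev MatlisDual (R : Type u) [CommRing R] (E M : Type u) [AddCommGroup E] [Module R E]
    [AddCommGroup M] [Module R M] : Type u :=
  M →ₗ[R] E

/-- For a submodule `N` of `M^∨`, the annihilator
`Ann_M N = {f ∈ Hom_R(M^∨, E) | f(N) = 0}`, a submodule of `M^∨∨` (which is identified with `M`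
when Matlis duality applies). -/
def matlisAnn {E M : Type u} [AddCommGroup E] [Module R E] [AddCommGroup M] [Module R M]
    (N : Submodule R (MatlisDual R E M)) : Submodule R (MatlisDual R E (MatlisDual R E M)) where
  carrier := {f | ∀ n ∈ N, f n = 0}
  zero_mem' := by intro n _; rfl
  add_mem' := by
    intro f g hf hg n hn
    rw [LinearMap.add_apply, hf n hn, hg n hn, add_zero]
  smul_mem' := by
    intro r f hf n hn
    rw [LinearMap.smul_apply, hf n hn, smul_zero]

end Matlis

section Rational

variable {R : Type u} [CommRing R] [IsLocalRing R] {d : ℕ}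
  {E ω : Type u} [AddCommGroup E] [Module R E] [AddCommGroup ω] [Module R ω]

/-- `τ_cl(ω) = Ann_ω 0^cl_{H^d_m(R)}`, where `φ` is the identification of `ω^∨` with
`H^d_m(R)`. -/
noncomputable def parameterTestSubmodule (c : ClosureOperation R)
    (φ : MatlisDual R E ω ≃ₗ[R] LocalCohomologyRing R d) :
    Submodule R (MatlisDual R E (MatlisDual R E ω)) :=
  matlisAnn ((c.cl (⊥ : Submodule R (LocalCohomologyRing R d))).map
    (φ.symm : LocalCohomologyRing R d →ₗ[R] MatlisDual R E ω))

/-- `R` is cl-rational: `Ann_ω 0^cl_{H^d_m(R)} = ω`. -/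
def IsClRational (c : ClosureOperation R)
    (φ : MatlisDual R E ω ≃ₗ[R] LocalCohomologyRing R d) : Prop :=
  parameterTestSubmodule c φ = ⊤

/-- The injective finiteness condition: `0^cl = 0^{cl_fg}` in `H^d_m(R)`. -/
def InjectiveFiniteness (c : ClosureOperation R) (d : ℕ) : Prop :=
  (c.cl (⊥ : Submodule R (LocalCohomologyRing R d)) : Set (LocalCohomologyRing R d)) =
    c.clFg (⊥ : Submodule R (LocalCohomologyRing R d))

/-- Every ideal generated by a system of parameters is cl-closed in `R`. -/
def ParameterIdealsClosed (c : ClosureOperation R) : Prop :=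
  ∀ (n : ℕ) (x : Fin n → R), IsSystemOfParameters x →
    c.cl (Ideal.span (Set.range x) : Submodule R R) = Ideal.span (Set.range x)

end Rational

end ClRationality

/-! Write H for the top local cohomology module. The injective hull E is a cogenerator, so Ann_ω
0^cl is everything exactly when 0^cl = 0 in H (`isClRational_iff`). By residuality an ideal I is
cl-closed exactly when 0^cl = 0 in R/I (`cl_eq_self_iff`), and by functoriality the vanishing of
0^cl passes from a module to anything embedded in it. The theorem thus reduces to two embeddings:
every R/I with I a parameter ideal embeds in H, and every finitely generated submodule of H embeds
in some such R/I. Injective finiteness serves to restrict the converse to finitely generated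
submodules.

Both embeddings come from one formula. A system of parameters generating I is a regular sequence, so
on modules A killed by I there is a natural isomorphism Ext^d(A, R) ≅ Hom(A, R/I). Hence Ext^d(-, R)
turns surjections between modules killed by a power of m into injections, and H = colim Ext^d(R/m^t,
R) is an increasing union. If m^t ⊆ I, then R/I → End(R/I) ≅ Ext^d(R/I, R) → Ext^d(R/m^t, R) → H is
injective; if I ⊆ m^t, then Ext^d(R/m^t, R) ≅ Hom(R/m^t, R/I) embeds in R/I by evaluation at 1.

Local cohomology is built from the derived functor `Ext`, whereas the dimension shifting is done in
`Abelian.Ext`; `exists_extEquiv` connects them. -/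

section

open CategoryTheory Limits Abelian
open scoped Pointwise

/-! ### Homology tested by maps to an injective object. -/

section HomologyDesc

variable {D : Type*} [Category* D] [Abelian D] {ι : Type*} {c : ComplexShape ι}

namespace HomologicalComplex

/-- The morphism out of the homology of `K` induced by a morphism that vanishes on boundaries. -/
noncomputable def homologyDesc (K : HomologicalComplex D c) (i : ι) {T : D} (t : K.X i ⟶ T)
    (ht : K.d (c.prev i) i ≫ t = 0) : K.homology i ⟶ T :=
  K.homologyι i ≫ K.descOpcycles t _ rfl ht

/-- Homology is a subobject of the opcycles, so a map from it to an injective object extends to the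
opcycles. -/
lemma homologyDesc_surjective (K : HomologicalComplex D c) (i : ι) {T : D} [Injective T]
    (α : K.homology i ⟶ T) :
    ∃ (t : K.X i ⟶ T) (ht : K.d (c.prev i) i ≫ t = 0), K.homologyDesc i t ht = α := by
  refine ⟨K.pOpcycles i ≫ Injective.factorThru α (K.homologyι i), by simp, ?_⟩
  have : K.descOpcycles (K.pOpcycles i ≫ Injective.factorThru α (K.homologyι i)) _ rfl (by simp) =
      Injective.factorThru α (K.homologyι i) := by
    rw [← cancel_epi (K.pOpcycles i), p_descOpcycles]
  rw [homologyDesc, this, Injective.comp_factorThru]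

lemma homologyDesc_eq_zero_iff (K : HomologicalComplex D c) (i : ι) {T : D} [Injective T]
    (t : K.X i ⟶ T) (ht : K.d (c.prev i) i ≫ t = 0) :
    K.homologyDesc i t ht = 0 ↔ ∃ g : K.X (c.next i) ⟶ T, K.d i (c.next i) ≫ g = t := by
  constructor
  · intro h
    let S : ShortComplex D :=
      ShortComplex.mk _ _ (K.homologyι_comp_fromOpcycles i (c.next i))
    have hS : S.Exact := ShortComplex.exact_of_f_is_kernel _ (K.homologyIsKernel i _ rfl)
    refine ⟨hS.descToInjective (K.descOpcycles t _ rfl ht) h, ?_⟩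
    have := hS.comp_descToInjective (K.descOpcycles t _ rfl ht) h
    rw [← K.p_fromOpcycles, Category.assoc]
    erw [this]
    simp
  · rintro ⟨g, hg⟩
    exact K.homologyι_descOpcycles_eq_zero_of_boundary t _ rfl g hg.symm

lemma homologyDesc_add (K : HomologicalComplex D c) (i : ι) {T : D} (s t : K.X i ⟶ T)
    (hs : K.d (c.prev i) i ≫ s = 0) (ht : K.d (c.prev i) i ≫ t = 0) :
    K.homologyDesc i (s + t) (by simp [hs, ht]) =
      K.homologyDesc i s hs + K.homologyDesc i t ht := by
  have : K.descOpcycles (s + t) _ rfl (by simp [hs, ht]) =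
      K.descOpcycles s _ rfl hs + K.descOpcycles t _ rfl ht := by
    rw [← cancel_epi (K.pOpcycles i)]
    simp
  simp [homologyDesc, this]

lemma homologyDesc_comp (K : HomologicalComplex D c) (i : ι) {T T' : D} (t : K.X i ⟶ T)
    (ht : K.d (c.prev i) i ≫ t = 0) (a : T ⟶ T') :
    K.homologyDesc i t ht ≫ a = K.homologyDesc i (t ≫ a) (by simp [reassoc_of% ht]) := by
  simp [homologyDesc, descOpcycles_comp]

lemma homologyMap_homologyDesc {K L : HomologicalComplex D c} (φ : K ⟶ L) (i : ι) {T : D}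
    (t : L.X i ⟶ T) (ht : L.d (c.prev i) i ≫ t = 0) :
    homologyMap φ i ≫ L.homologyDesc i t ht =
      K.homologyDesc i (φ.f i ≫ t) (by rw [← φ.comm_assoc, ht, comp_zero]) := by
  simp [homologyDesc]

end HomologicalComplex

end HomologyDesc

/-! ### Comparison of `Abelian.Ext` with the derived functor `Ext`. -/

namespace CategoryTheory.ProjectiveResolution

variable {R : Type u} [CommRing R] {C : Type*} [Category.{u} C] [Abelian C] [Linear R C]
  {X : C} (P : ProjectiveResolution X)

variable (R) in
/-- The cocycles of degree `n` of the complex of morphisms from a projective resolution to `Y`. -/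
def homCocycles (Y : C) (n : ℕ) : Submodule R (P.complex.X n ⟶ Y) :=
  LinearMap.ker (Linear.leftComp R Y (P.complex.d (n + 1) n))

lemma mem_homCocycles {Y : C} {n : ℕ} (f : P.complex.X n ⟶ Y) :
    f ∈ P.homCocycles R Y n ↔ P.complex.d (n + 1) n ≫ f = 0 := Iff.rfl

/-- A cochain is a coboundary if it factors through the differential. -/
def IsHomCoboundary {Y : C} {n : ℕ} (f : P.complex.X n ⟶ Y) : Prop :=
  ∃ g : P.complex.X ((ComplexShape.down ℕ).next n) ⟶ Y, P.complex.d n _ ≫ g = f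

section Small

variable [HasExt.{u} C]

variable (R) in
/-- The class of a cocycle in `Abelian.Ext`. -/
noncomputable def cocycleToExt (Y : C) (n : ℕ) : P.homCocycles R Y n →ₗ[R] Abelian.Ext X Y n where
  toFun f := P.extMk f.1 (n + 1) rfl ((P.mem_homCocycles _).1 f.2)
  map_add' f g := (P.add_extMk _ _ _ _ _ _).symm
  map_smul' r f := by
    rw [RingHom.id_apply, Abelian.Ext.smul_eq_comp_mk₀, extMk_comp_mk₀]
    simp

lemma cocycleToExt_surjective (Y : C) (n : ℕ) : Function.Surjective (P.cocycleToExt R Y n) := by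
  intro α
  obtain ⟨f, hf, rfl⟩ := P.extMk_surjective α (n + 1) rfl
  exact ⟨⟨f, hf⟩, rfl⟩

open CochainComplex.HomComplex in
lemma cocycleToExt_eq_zero_iff {Y : C} {n : ℕ} (f : P.homCocycles R Y n) :
    P.cocycleToExt R Y n f = 0 ↔ P.IsHomCoboundary f.1 := by
  rcases n with - | n
  · simp only [cocycleToExt, LinearMap.coe_mk, AddHom.coe_mk, IsHomCoboundary]
    -- In degree 0 the successor index defaults to 0 and the differential there is zero, so a
    -- coboundary is just 0. On the `Ext` side the same holds because the cochain complex vanishes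
    -- in degree 1.
    have h0 : P.complex.d 0 ((ComplexShape.down ℕ).next 0) = 0 := P.complex.shape _ _ (by simp)
    simp only [h0, zero_comp]
    constructor
    · intro h
      refine ⟨0, ?_⟩
      rw [← P.extEquivCohomologyClass.apply_eq_iff_eq, extEquivCohomologyClass_extMk,
        extEquivCohomologyClass_zero, CohomologyClass.mk_eq_zero_iff,
        Cocycle.toSingleMk_mem_coboundaries_iff _ _ _ _ _ 1 (by simp)] at h
      obtain ⟨g, hg⟩ := h
      have : IsZero (P.cochainComplex.X 1) := CochainComplex.isZero_of_isStrictlyLE _ 0 _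
      rw [this.eq_zero_of_src g, comp_zero] at hg
      rw [← cancel_epi (P.cochainComplexXIso (-(0 : ℕ)) 0 rfl).hom, ← hg, comp_zero]
    · rintro ⟨g, hg⟩
      simp [← hg]
  · have : (ComplexShape.down ℕ).next (n + 1) = n := ChainComplex.next_nat_succ n
    rw [IsHomCoboundary, this]
    exact P.extMk_eq_zero_iff f.1 _ rfl ((P.mem_homCocycles _).1 f.2) n rfl

end Small

section Derived

/-- An element of M is a map R ⟶ M, hence a map from M to R in the opposite category. As R becomes
injective there, elements of the derived functor can be studied with `homologyDesc`. -/
instance injective_op_self : Injective (Opposite.op (ModuleCat.of R R)) := by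
  have : Projective (ModuleCat.of R R) := (IsProjective.iff_projective (P := R)).1 inferInstance
  infer_instance

/-- The morphism `M ⟶ R` in the opposite category that sends `1` to the given element of `M`. -/
abbrev opToSpan {M : ModuleCat.{u} R} (x : M) : Opposite.op M ⟶ Opposite.op (ModuleCat.of R R) :=
  (ModuleCat.ofHom (LinearMap.toSpanSingleton R M x)).op

lemma opToSpan_add {M : ModuleCat.{u} R} (x y : M) :
    opToSpan (x + y) = opToSpan x + opToSpan y := by
  apply Quiver.Hom.unop_inj
  ext
  simp

lemma opToSpan_smul {M : ModuleCat.{u} R} (r : R) (x : M) : opToSpan (r • x) =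
    opToSpan x ≫ (ModuleCat.ofHom (r • LinearMap.id)).op := by
  apply Quiver.Hom.unop_inj
  ext
  simp

lemma opToSpan_unop_one {M : (ModuleCat.{u} R)ᵒᵖ} (α : M ⟶ Opposite.op (ModuleCat.of R R)) :
    opToSpan (M := M.unop) (α.unop.hom (1 : R)) = α := by
  apply Quiver.Hom.unop_inj
  ext
  simp

lemma comp_opToSpan {M N : ModuleCat.{u} R} (a : M ⟶ N) (x : M) :
    a.op ≫ opToSpan x = opToSpan (a x) := by
  apply Quiver.Hom.unop_inj
  ext
  simp

/-- The functor sending `X` to the module of morphisms from `X` to `Y`. -/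
noncomputable abbrev homFunctor (R : Type u) [CommRing R] [Linear R C] (Y : C) :
    C ⥤ (ModuleCat.{u} R)ᵒᵖ :=
  ((linearYoneda R C).obj Y).rightOp

variable (R) in
/-- The complex of morphisms from a projective resolution to `Y`, in the opposite category. -/
noncomputable abbrev homComplex (Y : C) :
    HomologicalComplex (ModuleCat.{u} R)ᵒᵖ (ComplexShape.down ℕ) :=
  ((homFunctor R Y).mapHomologicalComplex (ComplexShape.down ℕ)).obj P.complex

/-- A cochain, as a morphism in the opposite category. -/
abbrev homOp {Y : C} {n : ℕ} (f : P.complex.X n ⟶ Y) :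
    (P.homComplex R Y).X n ⟶ Opposite.op (ModuleCat.of R R) :=
  opToSpan (M := ModuleCat.of R (P.complex.X n ⟶ Y)) f

lemma d_comp_homOp {Y : C} {n : ℕ} (m : ℕ) (f : P.complex.X n ⟶ Y) :
    (P.homComplex R Y).d m n ≫ P.homOp f = P.homOp (P.complex.d m n ≫ f) :=
  comp_opToSpan (((linearYoneda R C).obj Y).map (P.complex.d m n).op) f

lemma opToSpan_injective (M : ModuleCat.{u} R) : Function.Injective (opToSpan (M := M)) := by
  intro x y h
  simpa using congr(($h).unop.hom (1 : R))

lemma opToSpan_zero (M : ModuleCat.{u} R) : opToSpan (0 : M) = 0 := by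
  apply Quiver.Hom.unop_inj
  ext
  simp

lemma d_comp_homOp_eq_zero {Y : C} {n : ℕ} (f : P.homCocycles R Y n) :
    (P.homComplex R Y).d ((ComplexShape.down ℕ).prev n) n ≫ P.homOp f.1 = 0 := by
  have : (ComplexShape.down ℕ).prev n = n + 1 := ChainComplex.prev ℕ n
  rw [d_comp_homOp, this, (P.mem_homCocycles _).1 f.2]
  exact opToSpan_zero _

variable [EnoughProjectives C]

variable (R) in
/-- The left derived functor of `Hom(-, Y)` is computed by a projective resolution. -/
noncomputable def derivedHomIso (Y : C) (n : ℕ) :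
    ((homFunctor R Y).leftDerived n).obj X ≅ (P.homComplex R Y).homology n :=
  P.isoLeftDerivedObj (homFunctor R Y) n

variable {P} in
variable (R) in
lemma derivedHomIso_naturality {X' : C} {P' : ProjectiveResolution X'} {g : X' ⟶ X}
    (φ : Hom P' P g) (Y : C) (n : ℕ) :
    ((homFunctor R Y).leftDerived n).map g ≫ (P.derivedHomIso R Y n).hom =
      (P'.derivedHomIso R Y n).hom ≫ HomologicalComplex.homologyMap
        (((homFunctor R Y).mapHomologicalComplex (ComplexShape.down ℕ)).map φ.hom) n :=
  isoLeftDerivedObj_hom_naturality g P' P φ.hom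
    (φ.hom_f_zero_comp_π_f_zero.trans
      (congrArg (CategoryStruct.comp (P'.π.f 0)) (ChainComplex.single₀_map_f_zero g))) _ n

variable (R) in
/-- The class of a cocycle in the derived functor `Ext`, as a morphism in the opposite category. -/
noncomputable def derivedClassOp {Y : C} {n : ℕ} (f : P.homCocycles R Y n) :
    ((homFunctor R Y).leftDerived n).obj X ⟶ Opposite.op (ModuleCat.of R R) :=
  (P.derivedHomIso R Y n).hom ≫
    (P.homComplex R Y).homologyDesc n (P.homOp f.1) (P.d_comp_homOp_eq_zero f)

variable (R) in
/-- The class of a cocycle in the derived functor `Ext`. -/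
noncomputable def cocycleToDerived (Y : C) (n : ℕ) :
    P.homCocycles R Y n →ₗ[R] (((homFunctor R Y).leftDerived n).obj X).unop where
  toFun f := (P.derivedClassOp R f).unop.hom (1 : R)
  map_add' f g := by
    apply opToSpan_injective
    rw [opToSpan_add, opToSpan_unop_one, opToSpan_unop_one, opToSpan_unop_one, derivedClassOp,
      derivedClassOp, derivedClassOp, ← Preadditive.comp_add, ← HomologicalComplex.homologyDesc_add]
    congr 2
    exact opToSpan_add _ _
  map_smul' r f := by
    apply opToSpan_injective
    rw [RingHom.id_apply, opToSpan_smul, opToSpan_unop_one, opToSpan_unop_one, derivedClassOp,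
      derivedClassOp, Category.assoc, HomologicalComplex.homologyDesc_comp]
    congr 2
    exact opToSpan_smul _ _

lemma opToSpan_cocycleToDerived {Y : C} {n : ℕ} (f : P.homCocycles R Y n) :
    opToSpan (P.cocycleToDerived R Y n f) = P.derivedClassOp R f :=
  opToSpan_unop_one (P.derivedClassOp R f)

lemma cocycleToDerived_surjective (Y : C) (n : ℕ) :
    Function.Surjective (P.cocycleToDerived R Y n) := by
  intro x
  obtain ⟨t, ht, h⟩ := (P.homComplex R Y).homologyDesc_surjective n
    ((P.derivedHomIso R Y n).inv ≫ opToSpan x)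
  obtain ⟨f, rfl⟩ : ∃ f, P.homOp f = t := ⟨t.unop.hom (1 : R), opToSpan_unop_one t⟩
  have hf : f ∈ P.homCocycles R Y n := by
    have hp : (ComplexShape.down ℕ).prev n = n + 1 := ChainComplex.prev ℕ n
    rw [d_comp_homOp, hp] at ht
    exact opToSpan_injective _ (ht.trans (opToSpan_zero _).symm)
  refine ⟨⟨f, hf⟩, opToSpan_injective _ ?_⟩
  rw [opToSpan_cocycleToDerived, derivedClassOp, h]
  exact Iso.hom_inv_id_assoc _ _

lemma cocycleToDerived_eq_zero_iff {Y : C} {n : ℕ} (f : P.homCocycles R Y n) :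
    P.cocycleToDerived R Y n f = 0 ↔ P.IsHomCoboundary f.1 := by
  rw [← (opToSpan_injective _).eq_iff, opToSpan_cocycleToDerived, opToSpan_zero, derivedClassOp,
    ← cancel_epi (P.derivedHomIso R Y n).inv, Iso.inv_hom_id_assoc, comp_zero]
  rw [HomologicalComplex.homologyDesc_eq_zero_iff]
  constructor
  · rintro ⟨t, ht⟩
    obtain ⟨g, rfl⟩ : ∃ g, P.homOp g = t := ⟨t.unop.hom (1 : R), opToSpan_unop_one t⟩
    exact ⟨g, opToSpan_injective (ModuleCat.of R (P.complex.X n ⟶ Y))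
      ((P.d_comp_homOp _ g).symm.trans ht)⟩
  · rintro ⟨g, hg⟩
    exact ⟨P.homOp g, by rw [d_comp_homOp, hg]⟩

variable {P} in
lemma cocycleToDerived_naturality {X' : C} {P' : ProjectiveResolution X'} {g : X' ⟶ X}
    (φ : Hom P' P g) {Y : C} {n : ℕ} (f : P.homCocycles R Y n) (f' : P'.homCocycles R Y n)
    (hf' : f'.1 = φ.hom.f n ≫ f.1) :
    (((homFunctor R Y).leftDerived n).map g).unop (P.cocycleToDerived R Y n f) =
      P'.cocycleToDerived R Y n f' := by
  apply opToSpan_injective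
  rw [opToSpan_cocycleToDerived, ← comp_opToSpan, opToSpan_cocycleToDerived, Quiver.Hom.op_unop,
    derivedClassOp, ← Category.assoc, derivedHomIso_naturality R φ, Category.assoc, derivedClassOp]
  congr 1
  refine (HomologicalComplex.homologyMap_homologyDesc _ _ _ _).trans ?_
  congr 1
  rw [hf']
  exact comp_opToSpan (((linearYoneda R C).obj Y).map (φ.hom.f n).op) f.1

end Derived

section Comparison

variable [EnoughProjectives C] [HasExt.{u} C]

lemma exists_linearEquiv_of_surjective {A B M : Type*} [AddCommGroup A] [AddCommGroup B]
    [AddCommGroup M] [Module R A] [Module R B] [Module R M] (a : M →ₗ[R] A) (b : M →ₗ[R] B)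
    (ha : Function.Surjective a) (hb : Function.Surjective b) (h : ∀ m, a m = 0 ↔ b m = 0) :
    ∃ e : A ≃ₗ[R] B, ∀ m, e (a m) = b m := by
  have hk : LinearMap.ker a = LinearMap.ker b := Submodule.ext h
  refine ⟨(a.quotKerEquivOfSurjective ha).symm ≪≫ₗ Submodule.quotEquivOfEq _ _ hk ≪≫ₗ
    b.quotKerEquivOfSurjective hb, fun m ↦ ?_⟩
  have : (a.quotKerEquivOfSurjective ha).symm (a m) = Submodule.Quotient.mk m := by
    rw [LinearEquiv.symm_apply_eq]
    rfl
  simp only [LinearEquiv.trans_apply, this]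
  rfl

-- Both modules are the cocycles of one projective resolution modulo the same coboundaries. A lift
-- of g to the resolutions computes both induced maps, whence naturality.
variable (R) in
lemma exists_extEquiv_leftDerived (Y : C) (n : ℕ) :
    ∃ e : ∀ X : C, Abelian.Ext X Y n ≃ₗ[R] (((homFunctor R Y).leftDerived n).obj X).unop,
      ∀ (X X' : C) (g : X' ⟶ X) (α : Abelian.Ext X Y n),
        e X' ((Abelian.Ext.mk₀ g).comp α (zero_add n)) =
          (((homFunctor R Y).leftDerived n).map g).unop (e X α) := by
  choose e he using fun X : C ↦ exists_linearEquiv_of_surjective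
    ((projectiveResolution X).cocycleToExt R Y n) ((projectiveResolution X).cocycleToDerived R Y n)
    (cocycleToExt_surjective _ _ _) (cocycleToDerived_surjective _ _ _)
    (fun m ↦ (cocycleToExt_eq_zero_iff _ m).trans (cocycleToDerived_eq_zero_iff _ m).symm)
  refine ⟨e, fun X X' g α ↦ ?_⟩
  obtain ⟨f, rfl⟩ := cocycleToExt_surjective (R := R) (projectiveResolution X) _ _ α
  let φ : Hom (projectiveResolution X') (projectiveResolution X) g :=
    ⟨lift g _ _, HomologicalComplex.congr_hom (lift_commutes g _ _) 0⟩
  let f' : (projectiveResolution X').homCocycles R Y n :=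
    ⟨φ.hom.f n ≫ f.1, by
      rw [mem_homCocycles, ← φ.hom.comm_assoc, (mem_homCocycles _ _).1 f.2, comp_zero]⟩
  rw [he, cocycleToDerived_naturality φ f f' rfl, ← he]
  congr 1
  exact mk₀_comp_extMk _ _ rfl ((mem_homCocycles _ _).1 f.2) φ

variable (R) in
/-- The two definitions of `Ext` agree, naturally in the first variable. -/
theorem exists_extEquiv (Y : C) (n : ℕ) :
    ∃ e : ∀ X : C, Abelian.Ext X Y n ≃ₗ[R] ((Ext R C n).obj (Opposite.op X)).obj Y,
      ∀ (X X' : C) (g : X' ⟶ X) (α : Abelian.Ext X Y n),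
        e X' ((Abelian.Ext.mk₀ g).comp α (zero_add n)) =
          (((Ext R C n).map g.op).app Y) (e X α) :=
  exists_extEquiv_leftDerived R Y n

end Comparison

end CategoryTheory.ProjectiveResolution

namespace ClRationality

/-! ### Dimension shifting for Ext along a regular sequence. -/

section ExtRegular

variable {R : Type u} [CommRing R]

/-- An element that annihilates `A` annihilates `Ext A N n`. -/
lemma ext_smul_eq_zero {A N : ModuleCat.{u} R} {r : R} (hr : ∀ a : A, r • a = 0) {n : ℕ}
    (α : Ext A N n) : r • α = 0 := by
  have h : r • 𝟙 A = 0 := by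
    ext a
    exact hr a
  have : r • α = (Ext.mk₀ (r • 𝟙 A)).comp α (zero_add n) := by simp [Ext.mk₀_smul]
  rw [this, h, Ext.mk₀_zero, Ext.zero_comp]

variable {N : ModuleCat.{u} R} {r : R}

lemma comp_mk₀_smulShortComplex_f {A : ModuleCat.{u} R} (hA : ∀ a : A, r • a = 0) {n : ℕ}
    (α : Ext A N n) :
    α.comp (Ext.mk₀ (ModuleCat.smulShortComplex N r).f) (add_zero n) = 0 := by
  have : α.comp (Ext.mk₀ (r • 𝟙 N)) (add_zero n) = 0 := by
    rw [← Ext.smul_eq_comp_mk₀, ext_smul_eq_zero hA]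
  exact this

/-- Composition with the extension class of `0 → N → N → N / r N → 0` is bijective in degrees where
the previous `Ext` module vanishes. -/
lemma comp_extClass_bijective (hr : IsSMulRegular N r) {A : ModuleCat.{u} R}
    (hA : ∀ a : A, r • a = 0) {n : ℕ}
    [Subsingleton (Ext A N n)] :
    Function.Bijective (fun α : Ext A (ModuleCat.smulShortComplex N r).X₃ n ↦
      α.comp hr.smulShortComplex_shortExact.extClass rfl) := by
  constructor
  · intro α β h
    rw [← sub_eq_zero]
    obtain ⟨γ, hγ⟩ := Ext.covariant_sequence_exact₃ A hr.smulShortComplex_shortExact (α - β) rfl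
      (by rw [sub_eq_add_neg, Ext.add_comp, Ext.neg_comp, ← sub_eq_add_neg, sub_eq_zero]; exact h)
    have h0 : γ = 0 := Subsingleton.elim (α := Ext A N n) _ _
    rw [← hγ, h0, Ext.zero_comp]
  · intro α
    exact Ext.covariant_sequence_exact₁ A hr.smulShortComplex_shortExact α
      (comp_mk₀_smulShortComplex_f hA α) rfl

/-- A homomorphism f satisfies r f(a) = f(r a) = 0, and r is regular on N. -/
lemma ext_zero_subsingleton (hr : IsSMulRegular N r) {A : ModuleCat.{u} R}
    (hA : ∀ a : A, r • a = 0) :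
    Subsingleton (Ext A N 0) := by
  refine ⟨fun α β ↦ ?_⟩
  apply (Ext.linearEquiv₀ (R := R)).injective
  ext a
  apply hr
  simp only
  rw [← map_smul, ← map_smul, hA, map_zero, map_zero]

/-- The vanishing of `Ext^i(A, N)` for `i ≤ d` passes to `Ext^i(A, N / r N)` for `i < d`. -/
lemma ext_subsingleton_smulShortComplex (hr : IsSMulRegular N r) {A : ModuleCat.{u} R} {d : ℕ}
    (h : ∀ i < d + 1, Subsingleton (Ext A N i)) :
    ∀ i < d, Subsingleton (Ext A (ModuleCat.smulShortComplex N r).X₃ i) := by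
  intro i hi
  have := h i (by lia)
  have hi' : Subsingleton (Ext A N (i + 1)) := h (i + 1) (by lia)
  refine subsingleton_of_forall_eq 0 fun α ↦ ?_
  obtain ⟨γ, rfl⟩ := Ext.covariant_sequence_exact₃ A hr.smulShortComplex_shortExact α rfl
    (hi'.elim _ _)
  have h0 : γ = 0 := Subsingleton.elim (α := Ext A N i) _ _
  rw [h0, Ext.zero_comp]

/-- If `rs` is weakly regular on `N`, then on modules annihilated by `rs` the functors
`Ext^i(-, N)` vanish for `i < length rs`, and `Ext^i(-, N)` is represented by `N / rs N` for
`i = length rs`. -/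
theorem exists_extClass_of_isWeaklyRegular (rs : List R) (N : ModuleCat.{u} R)
    (h : RingTheory.Sequence.IsWeaklyRegular N rs) :
    ∃ (Q : ModuleCat.{u} R) (_ : Q ≃ₗ[R] N ⧸ Ideal.ofList rs • (⊤ : Submodule R N))
      (ξ : Ext Q N rs.length), ∀ A : ModuleCat.{u} R, (∀ r ∈ rs, ∀ a : A, r • a = 0) →
        (∀ i < rs.length, Subsingleton (Ext A N i)) ∧
          Function.Bijective (fun f : A ⟶ Q ↦ (Ext.mk₀ f).comp ξ (zero_add _)) := by
  induction rs generalizing N with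
  | nil =>
    refine ⟨N, (Submodule.quotEquivOfEqBot _ (by simp)).symm, Ext.mk₀ (𝟙 N), fun A _ ↦
      ⟨by simp, ?_⟩⟩
    have : (fun f : A ⟶ N ↦ (Ext.mk₀ f).comp (Ext.mk₀ (𝟙 N)) (zero_add _)) = Ext.mk₀ :=
      funext fun f ↦ Ext.comp_mk₀_id _
    exact this.symm ▸ (Ext.mk₀_bijective A N :)
  | cons r rs ih =>
    rw [RingTheory.Sequence.isWeaklyRegular_cons_iff] at h
    obtain ⟨hr, hrs⟩ := h
    let N' := (ModuleCat.smulShortComplex N r).X₃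
    obtain ⟨Q, e, ξ, hξ⟩ := ih N' hrs
    -- The universal class for N is the Yoneda product of the one for N / r N with the class of 0 →
    -- N → N → N / r N → 0, which raises the degree by one.
    refine ⟨Q, e ≪≫ₗ (Submodule.quotOfListConsSMulTopEquivQuotSMulTopInner N r rs).symm,
      ξ.comp hr.smulShortComplex_shortExact.extClass rfl, fun A hA ↦ ?_⟩
    have hA' := hA r (by simp)
    obtain ⟨hv, hb⟩ := hξ A (fun s hs ↦ hA s (by simp [hs]))
    -- Once Ext^i(A, N) = 0, the connecting map Ext^i(A, N / r N) → Ext^(i+1)(A, N) is bijective, so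
    -- vanishing climbs one degree.
    have hvan : ∀ i < rs.length + 1, Subsingleton (Ext A N i) := by
      intro i hi
      induction i with
      | zero => exact ext_zero_subsingleton hr hA'
      | succ i ih' =>
        have := ih' (by lia)
        have := hv i (by lia)
        exact (comp_extClass_bijective hr hA').surjective.subsingleton
    refine ⟨hvan, ?_⟩
    have := hvan rs.length (by lia)
    have hcomp := (comp_extClass_bijective hr hA').comp hb
    have heq : (fun f : A ⟶ Q ↦ (Ext.mk₀ f).comp
        (ξ.comp hr.smulShortComplex_shortExact.extClass rfl) (zero_add _)) =
        (fun α ↦ α.comp hr.smulShortComplex_shortExact.extClass rfl) ∘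
          fun f ↦ (Ext.mk₀ f).comp ξ (zero_add _) :=
      funext fun f ↦ (Ext.comp_assoc _ _ _ _ _ (by lia)).symm
    exact heq.symm ▸ hcomp

end ExtRegular

/-! ### Depth measured by Ext from the residue field, and regular sequences. -/

section Depth

variable {R : Type u} [CommRing R] [IsLocalRing R]

/-- The modules `Ext^i(k, N)` vanish for `i < d`, where `k` is the residue field. -/
def ExtVanishes (N : ModuleCat.{u} R) (d : ℕ) : Prop :=
  ∀ i < d, Subsingleton (Ext (ModuleCat.of R (ResidueField R)) N i)

lemma smul_residueField_eq_zero {r : R} (hr : r ∈ maximalIdeal R) (a : ResidueField R) :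
    r • a = 0 := by
  rw [Algebra.smul_def]
  have : algebraMap R (ResidueField R) r = 0 := (residue_eq_zero_iff r).2 hr
  rw [this, zero_mul]

lemma extVanishes_of_isWeaklyRegular (N : ModuleCat.{u} R) (rs : List R)
    (hm : ∀ r ∈ rs, r ∈ maximalIdeal R) (h : RingTheory.Sequence.IsWeaklyRegular N rs) :
    ExtVanishes N rs.length := by
  obtain ⟨Q, -, ξ, hξ⟩ := exists_extClass_of_isWeaklyRegular rs N h
  exact (hξ _ fun r hr a ↦ smul_residueField_eq_zero (hm r hr) a).1

variable [IsNoetherianRing R]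

/-- Hom(k, N) = 0 yields an element of the annihilator of k, that is of the maximal ideal, regular
on N. -/
lemma exists_isSMulRegular_of_extVanishes (N : ModuleCat.{u} R) [Module.Finite R N] {d : ℕ}
    (h : ExtVanishes N (d + 1)) : ∃ r ∈ maximalIdeal R, IsSMulRegular N r := by
  have h0 := h 0 (by lia)
  have : Subsingleton (ResidueField R →ₗ[R] N) :=
    ((Ext.linearEquiv₀ (R := R)).trans (ModuleCat.homLinearEquiv (S := R)
      (M := ModuleCat.of R (ResidueField R)) (N := N))).symm.toEquiv.subsingleton
  obtain ⟨r, hr, hreg⟩ := IsSMulRegular.subsingleton_linearMap_iff.1 this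
  refine ⟨r, ?_, hreg⟩
  have := Module.mem_annihilator.1 hr (1 : ResidueField R)
  rw [Algebra.smul_def, mul_one] at this
  exact (residue_eq_zero_iff r).1 this

/-- An associated prime `p` of `N` is contained in an associated prime of `N / a N` containing `a`
when `a` is regular on `N`. -/
lemma exists_associatedPrimes_quotSMulTop (N : Type u) [AddCommGroup N] [Module R N]
    [Module.Finite R N] {a : R} (ha : a ∈ maximalIdeal R) (hreg : IsSMulRegular N a)
    {p : Ideal R} (hp : p ∈ associatedPrimes R N) :
    ∃ q ∈ associatedPrimes R (QuotSMulTop a N), p ≤ q ∧ a ∈ q ∧ a ∉ p := by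
  obtain ⟨hp, n, rfl⟩ := isAssociatedPrime_iff.1 hp
  have hn : n ≠ 0 := by
    rintro rfl
    exact hp.ne_top (by ext; simp [Submodule.mem_colon_singleton])
  have han : a ∉ (⊥ : Submodule R N).colon {n} := by
    simp only [Submodule.mem_colon_singleton, Submodule.mem_bot]
    exact fun h ↦ hn (hreg (by simpa using h))
  set p := (⊥ : Submodule R N).colon {n} with hpdef
  let U : Submodule R N := Submodule.torsionBySet R N p
  -- U is the part of N killed by p. If U ⊆ aN, then regularity of a gives U = aU, so U = 0 by
  -- Nakayama, although n ∈ U.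
  have hU : ¬ U ≤ a • (⊤ : Submodule R N) := by
    intro hle
    have hU0 : U = ⊥ := by
      refine Submodule.eq_bot_of_le_smul_of_le_jacobson_bot (Ideal.span {a}) U
        (IsNoetherian.noetherian U) ?_ ?_
      · intro x hx
        obtain ⟨y, -, rfl⟩ := (Submodule.mem_smul_pointwise_iff_exists _ _ _).1 (hle hx)
        rw [Submodule.ideal_span_singleton_smul]
        refine Submodule.smul_mem_pointwise_smul _ _ _ ?_
        rw [Submodule.mem_torsionBySet_iff] at hx ⊢
        intro b
        apply hreg
        have := hx b
        simp only [smul_zero]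
        rwa [smul_comm] at this
      · rw [IsLocalRing.jacobson_eq_maximalIdeal _ bot_ne_top, Ideal.span_singleton_le_iff_mem]
        exact ha
    have hnU : n ∈ U := by
      rw [Submodule.mem_torsionBySet_iff]
      rintro ⟨b, hb⟩
      simpa [hpdef, Submodule.mem_colon_singleton] using hb
    rw [hU0] at hnU
    exact hn (by simpa using hnU)
  obtain ⟨x, hxU, hx⟩ := SetLike.not_le_iff_exists.1 hU
  -- The class of x in N / aN is nonzero and killed by both p and a.
  obtain ⟨q, hq, hle⟩ := exists_le_isAssociatedPrime_of_isNoetherianRing R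
    (Submodule.Quotient.mk x : QuotSMulTop a N) (by rwa [ne_eq, Submodule.Quotient.mk_eq_zero])
  refine ⟨q, hq, fun b hb ↦ hle ?_, hle ?_, han⟩
  · rw [Submodule.mem_colon_singleton, Submodule.mem_bot, ← Submodule.Quotient.mk_smul]
    have := (Submodule.mem_torsionBySet_iff _ _).1 hxU ⟨b, hb⟩
    simp only at this
    rw [this, Submodule.Quotient.mk_zero]
  · rw [Submodule.mem_colon_singleton, Submodule.mem_bot, ← Submodule.Quotient.mk_smul,
      Submodule.Quotient.mk_eq_zero]
    exact Submodule.smul_mem_pointwise_smul _ _ _ trivial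

/-- Prime ideals associated to `N` have dimension at least the depth of `N`. -/
lemma le_ringKrullDim_quotient_of_extVanishes (d : ℕ) (N : ModuleCat.{u} R) [Module.Finite R N]
    (h : ExtVanishes N d) {p : Ideal R} (hp : p ∈ associatedPrimes R N) :
    (d : WithBot ℕ∞) ≤ ringKrullDim (R ⧸ p) := by
  induction d generalizing N p with
  | zero =>
    have := hp.isPrime
    exact ringKrullDim_nonneg_of_nontrivial
  | succ d ih =>
    have := hp.isPrime
    obtain ⟨a, ha, hreg⟩ := exists_isSMulRegular_of_extVanishes N h
    obtain ⟨q, hq, hle, haq, hap⟩ := exists_associatedPrimes_quotSMulTop N ha hreg hp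
    have : Module.Finite R (ModuleCat.smulShortComplex N a).X₃ :=
      inferInstanceAs (Module.Finite R (QuotSMulTop a N))
    have hd := ih (ModuleCat.smulShortComplex N a).X₃
      (ext_subsingleton_smulShortComplex hreg h) hq
    -- The element a is nonzero in the domain R / p and dies in R / q, so the dimension drops by at
    -- least one.
    have hlt := ringKrullDim_succ_le_of_surjective (Ideal.Quotient.factor hle)
      (Ideal.Quotient.factor_surjective hle) (r := Ideal.Quotient.mk p a)
      (mem_nonZeroDivisors_of_ne_zero (by rwa [ne_eq, Ideal.Quotient.eq_zero_iff_mem]))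
      (by rwa [Ideal.Quotient.factor_mk, Ideal.Quotient.eq_zero_iff_mem])
    push_cast
    exact (add_le_add_left hd 1).trans hlt

/-- The maximal ideal of R / p is minimal over the images of `xs`, so Krull's height theorem
applies. -/
lemma ringKrullDim_quotient_le_length {p : Ideal R} [p.IsPrime] (xs : List R)
    (hxs : ∀ x ∈ xs, x ∈ maximalIdeal R)
    (h : maximalIdeal R ≤ (p ⊔ Ideal.ofList xs).radical) :
    ringKrullDim (R ⧸ p) ≤ xs.length := by
  classical
  have : IsLocalRing (R ⧸ p) :=
    IsLocalRing.of_surjective' (Ideal.Quotient.mk p) Ideal.Quotient.mk_surjective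
  have hcomap : (maximalIdeal (R ⧸ p)).comap (Ideal.Quotient.mk p) = maximalIdeal R :=
    IsLocalRing.eq_maximalIdeal
      (Ideal.comap_isMaximal_of_surjective _ Ideal.Quotient.mk_surjective)
  let s : Finset (R ⧸ p) := (xs.map (Ideal.Quotient.mk p)).toFinset
  have hmin : maximalIdeal (R ⧸ p) ∈ (Ideal.span (s : Set (R ⧸ p))).minimalPrimes := by
    refine ⟨⟨inferInstance, Ideal.span_le.2 fun y hy ↦ ?_⟩, fun Q hQ _ ↦ ?_⟩
    · obtain ⟨x, hx, rfl⟩ : ∃ x ∈ xs, Ideal.Quotient.mk p x = y := by simpa [s] using hy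
      exact hcomap.ge (hxs x hx)
    · have hQp := hQ.1
      have hle : p ⊔ Ideal.ofList xs ≤ Q.comap (Ideal.Quotient.mk p) := by
        refine sup_le (fun x hx ↦ ?_) (Ideal.span_le.2 fun x hx ↦ hQ.2 (Ideal.subset_span ?_))
        · rw [Ideal.mem_comap, Ideal.Quotient.eq_zero_iff_mem.2 hx]
          exact Q.zero_mem
        · simpa [s] using ⟨x, hx, rfl⟩
      intro y hy
      obtain ⟨x, rfl⟩ := Ideal.Quotient.mk_surjective y
      have hx : x ∈ maximalIdeal R := hcomap.le hy
      have : (Q.comap (Ideal.Quotient.mk p)).IsPrime := inferInstance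
      exact (this.radical_le_iff.2 hle) (h hx)
  rw [← IsLocalRing.maximalIdeal_height_eq_ringKrullDim]
  have h1 := Ideal.height_le_card_of_mem_minimalPrimes_span_finset hmin
  have h2 : s.card ≤ xs.length := (List.toFinset_card_le _).trans (by simp)
  exact_mod_cast h1.trans (by exact_mod_cast h2)

omit [IsLocalRing R] [IsNoetherianRing R] in
lemma annihilator_sup_span_le_annihilator_quotSMulTop (N : Type u) [AddCommGroup N] [Module R N]
    (x : R) : Module.annihilator R N ⊔ Ideal.span {x} ≤ Module.annihilator R (QuotSMulTop x N) := by
  refine sup_le (LinearMap.annihilator_le_of_surjective (R := R) (M := N)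
    (Submodule.mkQ (x • (⊤ : Submodule R N))) (Submodule.mkQ_surjective _)) ?_
  rw [Ideal.span_singleton_le_iff_mem, Module.mem_annihilator]
  intro y
  obtain ⟨y, rfl⟩ := Submodule.Quotient.mk_surjective _ y
  rw [← Submodule.Quotient.mk_smul, Submodule.Quotient.mk_eq_zero]
  exact Submodule.smul_mem_pointwise_smul _ _ _ trivial

/-- In a module of depth at least `length xs`, the sequence `xs` is weakly regular as soon as it
generates, modulo the annihilator, an ideal primary to the maximal ideal. -/
theorem isWeaklyRegular_of_extVanishes (xs : List R) (hxs : ∀ x ∈ xs, x ∈ maximalIdeal R)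
    (N : ModuleCat.{u} R) [Module.Finite R N] (h : ExtVanishes N xs.length)
    (hm : maximalIdeal R ≤ (Module.annihilator R N ⊔ Ideal.ofList xs).radical) :
    RingTheory.Sequence.IsWeaklyRegular N xs := by
  induction xs generalizing N with
  | nil => exact ⟨fun i hi ↦ absurd hi (by simp)⟩
  | cons x xs ih =>
    have hreg : IsSMulRegular N x := by
      -- A zero divisor x lies in an associated prime p. Depth forces dim R / p ≥ length xs + 1, but
      -- xs alone is already primary modulo p, so dim R / p ≤ length xs.
      by_contra hx
      have hx' : x ∈ ⋃ p ∈ associatedPrimes R N, (p : Set R) := by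
        rw [biUnion_associatedPrimes_eq_compl_regular]
        exact hx
      obtain ⟨p, hp, hxp⟩ := Set.mem_iUnion₂.1 hx'
      have := hp.isPrime
      have h1 := le_ringKrullDim_quotient_of_extVanishes _ N h hp
      have h2 := ringKrullDim_quotient_le_length (p := p) xs
        (fun y hy ↦ hxs y (List.mem_cons_of_mem _ hy)) (hm.trans (Ideal.radical_mono ?_))
      · have h3 := h1.trans h2
        have h4 : (x :: xs).length ≤ xs.length := by exact_mod_cast h3
        simp at h4
      · have hann : Module.annihilator R N ≤ p := by
          rw [← Submodule.annihilator_top]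
          exact hp.annihilator_le
        refine sup_le (hann.trans le_sup_left) ?_
        rw [Ideal.ofList_cons]
        exact sup_le (((Ideal.span_singleton_le_iff_mem _).2 hxp).trans le_sup_left) le_sup_right
    rw [RingTheory.Sequence.isWeaklyRegular_cons_iff]
    have : Module.Finite R (ModuleCat.smulShortComplex N x).X₃ :=
      inferInstanceAs (Module.Finite R (QuotSMulTop x N))
    -- Passing to N / xN removes x from the list but puts it into the annihilator; this is why the
    -- primary condition is stated modulo the annihilator.
    refine ⟨hreg, ih (fun y hy ↦ hxs y (List.mem_cons_of_mem _ hy))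
      (ModuleCat.smulShortComplex N x).X₃ (ext_subsingleton_smulShortComplex hreg h)
      (hm.trans (Ideal.radical_mono ?_))⟩
    rw [Ideal.ofList_cons, ← sup_assoc]
    exact sup_le_sup_right (annihilator_sup_span_le_annihilator_quotSMulTop N x) _

end Depth

/-! ### Systems of parameters in Cohen–Macaulay rings. -/

section Parameters

variable {R : Type u} [CommRing R] [IsLocalRing R]

lemma IsSystemOfParameters.mem_maximalIdeal {n : ℕ} {x : Fin n → R} (hx : IsSystemOfParameters x)
    (i : Fin n) : x i ∈ maximalIdeal R :=
  hx.2 ▸ Ideal.le_radical (Ideal.subset_span ⟨i, rfl⟩)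

lemma IsSystemOfParameters.pow {n : ℕ} {x : Fin n → R} (hx : IsSystemOfParameters x) (t : ℕ) :
    IsSystemOfParameters (fun i ↦ x i ^ (t + 1)) := by
  refine ⟨hx.1, le_antisymm ?_ ?_⟩
  · refine (Ideal.IsPrime.radical_le_iff inferInstance).2 (Ideal.span_le.2 ?_)
    rintro - ⟨i, rfl⟩
    exact Ideal.pow_mem_of_mem _ (hx.mem_maximalIdeal i) _ t.succ_pos
  · rw [← hx.2]
    refine Ideal.radical_le_radical_iff.2 (Ideal.span_le.2 ?_)
    rintro - ⟨i, rfl⟩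
    exact ⟨t + 1, Ideal.subset_span ⟨i, rfl⟩⟩

omit [IsLocalRing R] in
lemma ofList_ofFn {n : ℕ} (x : Fin n → R) :
    Ideal.ofList (List.ofFn x) = Ideal.span (Set.range x) := by
  rw [Ideal.ofList]
  congr 1
  ext
  simp

variable [IsNoetherianRing R]

/-- A regular sequence of length dim R cuts the dimension to 0, so every prime containing it is
maximal. -/
lemma exists_isSystemOfParameters (hCM : IsCohenMacaulayLocal R) :
    ∃ (n : ℕ) (x : Fin n → R), IsSystemOfParameters x := by
  obtain ⟨rs, hrs, hreg, hd⟩ := hCM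
  refine ⟨rs.length, rs.get, hd.symm, ?_⟩
  have hI : Ideal.span (Set.range rs.get) = Ideal.ofList rs := by
    rw [← ofList_ofFn, List.ofFn_get]
  have hdim := ringKrullDim_add_length_eq_ringKrullDim_of_isRegular rs hreg
  rw [hI]
  have hle : Ideal.ofList rs ≤ maximalIdeal R := Ideal.span_le.2 hrs
  refine le_antisymm ((Ideal.IsPrime.radical_le_iff inferInstance).2 hle) ?_
  have h0 : ringKrullDim (R ⧸ Ideal.ofList rs) ≤ 0 := by
    rw [← hd] at hdim
    cases h : ringKrullDim (R ⧸ Ideal.ofList rs) with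
    | bot => exact bot_le
    | coe a =>
      rw [h] at hdim
      have h1 : a + (rs.length : ℕ∞) = rs.length := by exact_mod_cast hdim
      have h2 : a = 0 := by
        exact WithTop.add_right_cancel (ENat.natCast_ne_top rs.length)
          (h1.trans (zero_add (rs.length : ℕ∞)).symm)
      rw [h2]
      exact le_rfl
  have : Ring.KrullDimLE 0 (R ⧸ Ideal.ofList rs) := Ring.krullDimLE_iff.2 h0
  rw [Ideal.radical_eq_sInf]
  refine le_sInf fun p ⟨hp, hprime⟩ ↦ ?_
  have hmap : (p.map (Ideal.Quotient.mk (Ideal.ofList rs))).IsPrime :=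
    Ideal.map_isPrime_of_surjective Ideal.Quotient.mk_surjective (by rwa [Ideal.mk_ker])
  have hmax := Ideal.comap_isMaximal_of_surjective (Ideal.Quotient.mk (Ideal.ofList rs))
    Ideal.Quotient.mk_surjective (K := p.map (Ideal.Quotient.mk (Ideal.ofList rs)))
  rw [Ideal.comap_map_of_surjective' _ Ideal.Quotient.mk_surjective, Ideal.mk_ker,
    sup_eq_left.2 hp] at hmax
  exact (IsLocalRing.eq_maximalIdeal hmax).ge

lemma exists_isSystemOfParameters_le_pow (hCM : IsCohenMacaulayLocal R) {d : ℕ}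
    (hd : ringKrullDim R = (d : WithBot ℕ∞)) (t : ℕ) :
    ∃ x : Fin d → R, IsSystemOfParameters x ∧
      Ideal.span (Set.range x) ≤ maximalIdeal R ^ t := by
  obtain ⟨n, x, hx⟩ := exists_isSystemOfParameters hCM
  obtain rfl : n = d := by exact_mod_cast hx.1.symm.trans hd
  -- The exponent is t + 1 so that it stays positive when t = 0.
  refine ⟨_, hx.pow t, Ideal.span_le.2 ?_⟩
  rintro - ⟨i, rfl⟩
  exact Ideal.pow_le_pow_right t.le_succ (Ideal.pow_mem_pow (hx.mem_maximalIdeal i) _)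

/-- In a Cohen-Macaulay local ring every system of parameters is a regular sequence. -/
lemma IsSystemOfParameters.isWeaklyRegular (hCM : IsCohenMacaulayLocal R) {n : ℕ} {x : Fin n → R}
    (hx : IsSystemOfParameters x) : RingTheory.Sequence.IsWeaklyRegular R (List.ofFn x) := by
  obtain ⟨rs, hrs, hreg, hd⟩ := hCM
  have hlen : (List.ofFn x).length = rs.length := by
    rw [List.length_ofFn]
    exact_mod_cast hx.1.symm.trans hd.symm
  -- The given sequence `rs` supplies the Ext vanishing, a condition that no longer refers to `rs`
  -- and so can be used for x.
  refine isWeaklyRegular_of_extVanishes (List.ofFn x) ?_ (ModuleCat.of R R) ?_ ?_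
  · simpa using hx.mem_maximalIdeal
  · rw [hlen]
    exact extVanishes_of_isWeaklyRegular (ModuleCat.of R R) rs hrs hreg.1
  · rw [ofList_ofFn]
    exact hx.2.ge.trans (Ideal.radical_mono le_sup_right)

/-- For a system of parameters generating `I`, the functor `Ext^d(-, R)` is represented by `R / I`
on modules annihilated by `I`. -/
lemma IsSystemOfParameters.exists_extClass (hCM : IsCohenMacaulayLocal R) {d : ℕ} {x : Fin d → R}
    (hx : IsSystemOfParameters x) :
    ∃ ξ : Abelian.Ext (ModuleCat.of R (R ⧸ Ideal.span (Set.range x))) (ModuleCat.of R R) d,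
      ∀ A : ModuleCat.{u} R, (∀ r ∈ Ideal.span (Set.range x), ∀ a : A, r • a = 0) →
        Function.Bijective (fun f : A ⟶ ModuleCat.of R (R ⧸ Ideal.span (Set.range x)) ↦
          (Ext.mk₀ f).comp ξ (zero_add _)) := by
  have key := exists_extClass_of_isWeaklyRegular (List.ofFn x) (ModuleCat.of R R)
    (hx.isWeaklyRegular hCM)
  rw [List.length_ofFn] at key
  obtain ⟨Q, e, ξ, hξ⟩ := key
  have hI : Ideal.ofList (List.ofFn x) • (⊤ : Submodule R R) = Ideal.span (Set.range x) := by
    rw [ofList_ofFn, smul_eq_mul, Ideal.mul_top]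
  let e' : ModuleCat.of R (R ⧸ Ideal.span (Set.range x)) ≅ Q :=
    (e ≪≫ₗ Submodule.quotEquivOfEq _ _ hI).symm.toModuleIso
  refine ⟨(Ext.mk₀ e'.hom).comp ξ (zero_add _), fun A hA ↦ ?_⟩
  let e'' : (A ⟶ ModuleCat.of R (R ⧸ Ideal.span (Set.range x))) ≃ (A ⟶ Q) := e'.homToEquiv
  have hb := (hξ A fun r hr ↦ hA r (by
    rw [← ofList_ofFn]; exact Ideal.subset_span hr)).2.comp e''.bijective
  have heq : (fun f : A ⟶ ModuleCat.of R (R ⧸ Ideal.span (Set.range x)) ↦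
      (Ext.mk₀ f).comp ((Ext.mk₀ e'.hom).comp ξ (zero_add _)) (zero_add _)) =
      (fun f ↦ (Ext.mk₀ f).comp ξ (zero_add _)) ∘ e'' := by
    funext f
    simp [e'']
  exact heq.symm ▸ hb

end Parameters

/-! ### Top local cohomology as a union, and the two embeddings. -/

section LocalCohomology

variable {R : Type u} [CommRing R] [IsLocalRing R] [IsNoetherianRing R]

/-- For a parameter ideal I ⊆ m^t, both modules are killed by I, so the map becomes Hom(B, R/I) →
Hom(A, R/I), precomposition with an epimorphism. -/
lemma ext_map_injective (hCM : IsCohenMacaulayLocal R) {d : ℕ}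
    (hd : ringKrullDim R = (d : WithBot ℕ∞)) {A B : ModuleCat.{u} R} (g : A ⟶ B)
    (hg : Function.Surjective g) {t : ℕ} (hA : ∀ r ∈ maximalIdeal R ^ t, ∀ a : A, r • a = 0) :
    Function.Injective
      (((_root_.Ext R (ModuleCat.{u} R) d).map g.op).app (ModuleCat.of R R)) := by
  obtain ⟨x, hx, hxt⟩ := exists_isSystemOfParameters_le_pow hCM hd t
  obtain ⟨ξ, hξ⟩ := hx.exists_extClass hCM
  obtain ⟨e, he⟩ := ProjectiveResolution.exists_extEquiv R (ModuleCat.of R R) d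
  have hA' : ∀ r ∈ Ideal.span (Set.range x), ∀ a : A, r • a = 0 := fun r hr ↦ hA r (hxt hr)
  have hB' : ∀ r ∈ Ideal.span (Set.range x), ∀ b : B, r • b = 0 := by
    intro r hr b
    obtain ⟨a, rfl⟩ := hg b
    rw [← map_smul, hA' r hr, map_zero]
  have hepi : Epi g := (ModuleCat.epi_iff_surjective g).2 hg
  intro y₁ y₂ h
  obtain ⟨α₁, rfl⟩ := (e B).surjective y₁
  obtain ⟨α₂, rfl⟩ := (e B).surjective y₂
  obtain ⟨f₁, rfl⟩ := (hξ B hB').surjective α₁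
  obtain ⟨f₂, rfl⟩ := (hξ B hB').surjective α₂
  rw [← he, ← he] at h
  have h' := (e A).injective h
  simp only [Ext.mk₀_comp_mk₀_assoc] at h'
  rw [(cancel_epi g).1 ((hξ A hA').injective h')]

-- Elements identified in a filtered colimit agree after two maps to a later stage; coequalizing
-- these maps gives one injective transition map identifying them.
omit [IsLocalRing R] [IsNoetherianRing R] in
lemma injective_ι_of_injective_map {J : Type} [SmallCategory J] [IsFiltered J]
    (K : J ⥤ ModuleCat.{u} R) (hK : ∀ {i j : J} (f : i ⟶ j), Function.Injective (K.map f))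
    {s : Cocone K} (hs : IsColimit s) (i : J) : Function.Injective (s.ι.app i) := by
  have := preservesFilteredColimitsOfSize_shrink.{0, u, 0, u} (forget (ModuleCat.{u} R))
  intro a b h
  obtain ⟨k, f, g, hfg⟩ := (Concrete.isColimit_rep_eq_iff_exists K hs a b).1 h
  have h2 := congr(K.map (IsFiltered.coeqHom f g) $hfg)
  rw [← ConcreteCategory.comp_apply, ← ConcreteCategory.comp_apply, ← K.map_comp, ← K.map_comp,
    ← IsFiltered.coeq_condition f g] at h2
  exact hK _ h2

lemma smul_quotient_eq_zero {S : Type*} [CommRing S] {I : Ideal S} {r : S} (hr : r ∈ I)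
    (a : S ⧸ I) : r • a = 0 := by
  rw [Algebra.smul_def, Ideal.Quotient.algebraMap_eq, Ideal.Quotient.eq_zero_iff_mem.2 hr, zero_mul]

variable (R) in
/-- The module `Ext^d(A, R)`. -/
noncomputable abbrev extRing (d : ℕ) (A : ModuleCat.{u} R) : ModuleCat.{u} R :=
  ((_root_.Ext R (ModuleCat.{u} R) d).obj (Opposite.op A)).obj (ModuleCat.of R R)

/-- In a Cohen-Macaulay local ring, the top local cohomology module is the increasing union of the
modules `Ext^d(R / m^t, R)`. -/
lemma exists_exhausting_embeddings (hCM : IsCohenMacaulayLocal R) {d : ℕ}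
    (hd : ringKrullDim R = (d : WithBot ℕ∞)) :
    ∃ j : ∀ t : ℕ, extRing R d (ModuleCat.of R (R ⧸ maximalIdeal R ^ t)) →ₗ[R]
        LocalCohomologyRing R d,
      (∀ t, Function.Injective (j t)) ∧ Monotone (fun t ↦ LinearMap.range (j t)) ∧
        ∀ x, ∃ t, x ∈ LinearMap.range (j t) := by
  let F := localCohomology.diagram (localCohomology.idealPowersDiagram (maximalIdeal R)) d
  have : HasColimit F := localCohomology.hasColimitDiagram.{u, 0} _ d
  let ev := (evaluation (ModuleCat.{u} R) (ModuleCat.{u} R)).obj (ModuleCat.of R R)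
  let s : Cocone (F ⋙ ev) := ev.mapCocone (colimit.cocone F)
  have hs : IsColimit s := isColimitOfPreserves ev (colimit.isColimit F)
  have hinj : ∀ {i j} (f : i ⟶ j), Function.Injective ((F ⋙ ev).map f) := by
    intro i j f
    refine ext_map_injective hCM hd (t := j.unop.unop)
      ((localCohomology.ringModIdeals
        (localCohomology.idealPowersDiagram (maximalIdeal R))).map f.unop) ?_ ?_
    · intro y
      obtain ⟨y, rfl⟩ := Submodule.Quotient.mk_surjective _ y
      exact ⟨Submodule.Quotient.mk y, rfl⟩
    · exact fun r hr a ↦ smul_quotient_eq_zero hr a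
  -- The powers of m are indexed by ℕᵒᵖ and Ext is contravariant, hence the double opposite.
  refine ⟨fun t ↦ (s.ι.app (Opposite.op (Opposite.op t))).hom,
    fun t ↦ injective_ι_of_injective_map _ hinj hs _, ?_, ?_⟩
  · intro t t' htt'
    let f : Opposite.op (Opposite.op t) ⟶ Opposite.op (Opposite.op t') := (homOfLE htt').op.op
    rintro - ⟨y, rfl⟩
    refine ⟨(F ⋙ ev).map f y, ?_⟩
    exact ConcreteCategory.congr_hom (s.w f) y
  · intro x
    have := preservesFilteredColimitsOfSize_shrink.{0, u, 0, u} (forget (ModuleCat.{u} R))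
    obtain ⟨i, y, hy⟩ := Concrete.isColimit_exists_rep _ hs x
    exact ⟨i.unop.unop, y, hy⟩

lemma IsSystemOfParameters.exists_linearEquiv (hCM : IsCohenMacaulayLocal R) {d : ℕ}
    {x : Fin d → R} (hx : IsSystemOfParameters x) (A : ModuleCat.{u} R)
    (hA : ∀ r ∈ Ideal.span (Set.range x), ∀ a : A, r • a = 0) :
    Nonempty ((A →ₗ[R] (R ⧸ Ideal.span (Set.range x))) ≃ₗ[R] extRing R d A) := by
  obtain ⟨ξ, hξ⟩ := hx.exists_extClass hCM
  obtain ⟨e, -⟩ := ProjectiveResolution.exists_extEquiv R (ModuleCat.of R R) d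
  let f : (A ⟶ ModuleCat.of R (R ⧸ Ideal.span (Set.range x))) →ₗ[R]
      Abelian.Ext A (ModuleCat.of R R) d :=
    { toFun f := (Ext.mk₀ f).comp ξ (zero_add _)
      map_add' := by simp [Ext.mk₀_add]
      map_smul' := by simp [Ext.mk₀_smul] }
  exact ⟨(ModuleCat.homLinearEquiv (S := R) (M := A)
    (N := ModuleCat.of R (R ⧸ Ideal.span (Set.range x)))).symm ≪≫ₗ
    LinearEquiv.ofBijective f (hξ A hA) ≪≫ₗ e A⟩

/-- For a system of parameters generating `I`, the module `R / I` embeds into the top local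
cohomology module. -/
lemma IsSystemOfParameters.exists_embedding (hCM : IsCohenMacaulayLocal R) {d : ℕ} {x : Fin d → R}
    (hx : IsSystemOfParameters x) :
    ∃ f : (R ⧸ Ideal.span (Set.range x)) →ₗ[R] LocalCohomologyRing R d, Function.Injective f := by
  set I := Ideal.span (Set.range x) with hI
  obtain ⟨t, ht⟩ := Ideal.exists_pow_le_of_le_radical_of_fg hx.2.ge (IsNoetherian.noetherian _)
  obtain ⟨j, hj, -, -⟩ := exists_exhausting_embeddings hCM hx.1
  obtain ⟨e⟩ := hx.exists_linearEquiv hCM (ModuleCat.of R (R ⧸ I))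
    fun r hr a ↦ smul_quotient_eq_zero hr a
  let g : ModuleCat.of R (R ⧸ maximalIdeal R ^ t) ⟶ ModuleCat.of R (R ⧸ I) :=
    ModuleCat.ofHom (Submodule.factor ht)
  have hg := ext_map_injective hCM hx.1 g (Submodule.factor_surjective ht)
    fun r hr a ↦ smul_quotient_eq_zero hr a
  -- An element acts by multiplication and is recovered as the value at 1.
  let m : (R ⧸ I) →ₗ[R] ((R ⧸ I) →ₗ[R] (R ⧸ I)) := (LinearMap.mul R (R ⧸ I))
  have hm : Function.Injective m := fun a b h ↦ by
    simpa [m] using LinearMap.congr_fun h 1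
  exact ⟨j t ∘ₗ (((_root_.Ext R (ModuleCat.{u} R) d).map g.op).app (ModuleCat.of R R)).hom ∘ₗ
    e.toLinearMap ∘ₗ m, (hj t).comp (hg.comp (e.injective.comp hm))⟩

/-- A finitely generated submodule of the top local cohomology module embeds into `R / I` for an
ideal `I` generated by a system of parameters. -/
lemma exists_embedding_of_fg (hCM : IsCohenMacaulayLocal R) {d : ℕ}
    (hd : ringKrullDim R = (d : WithBot ℕ∞)) (N : Submodule R (LocalCohomologyRing R d))
    (hN : N.FG) :
    ∃ x : Fin d → R, IsSystemOfParameters x ∧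
      ∃ f : N →ₗ[R] (R ⧸ Ideal.span (Set.range x)), Function.Injective f := by
  obtain ⟨j, hj, hmono, hex⟩ := exists_exhausting_embeddings hCM hd
  -- Finitely many generators lie in a single stage of the increasing union.
  obtain ⟨t, ht⟩ : ∃ t, N ≤ LinearMap.range (j t) := by
    obtain ⟨S, rfl⟩ := hN
    choose t ht using hex
    refine ⟨S.sup t, Submodule.span_le.2 fun y hy ↦ hmono (Finset.le_sup hy) (ht y)⟩
  obtain ⟨x, hx, hxt⟩ := exists_isSystemOfParameters_le_pow hCM hd t
  obtain ⟨e⟩ := hx.exists_linearEquiv hCM (ModuleCat.of R (R ⧸ maximalIdeal R ^ t))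
    fun r hr a ↦ smul_quotient_eq_zero (hxt hr) a
  let ev : ((R ⧸ maximalIdeal R ^ t) →ₗ[R] (R ⧸ Ideal.span (Set.range x))) →ₗ[R]
      (R ⧸ Ideal.span (Set.range x)) := LinearMap.applyₗ (1 : R ⧸ maximalIdeal R ^ t)
  have hev : Function.Injective ev := fun f g h ↦ by
    refine Submodule.linearMap_qext _ (LinearMap.ext_ring ?_)
    simpa [ev] using h
  refine ⟨x, hx, ev ∘ₗ e.symm.toLinearMap ∘ₗ
    (LinearEquiv.ofInjective (j t) (hj t)).symm.toLinearMap ∘ₗ Submodule.inclusion ht, ?_⟩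
  exact hev.comp (e.symm.injective.comp ((LinearEquiv.symm _).injective.comp
    (Submodule.inclusion_injective ht)))

end LocalCohomology

/-! ### Formal consequences of functoriality and residuality. -/

section Closure

variable {R : Type u} [CommRing R] {c : ClosureOperation R}

/-- Functoriality sends the closure of 0 in M into the closure of 0 in N. -/
lemma cl_bot_eq_bot_of_injective (hfun : c.IsFunctorial) {M N : Type u} [AddCommGroup M]
    [Module R M] [AddCommGroup N] [Module R N] (f : M →ₗ[R] N) (hf : Function.Injective f)
    (hN : c.cl (⊥ : Submodule R N) = ⊥) : c.cl (⊥ : Submodule R M) = ⊥ := by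
  have h := hfun M N f ⊥
  rw [Submodule.map_bot, hN] at h
  exact Submodule.map_injective_of_injective hf ((le_bot_iff.1 h).trans (Submodule.map_bot f).symm)

lemma cl_eq_self_iff (hres : c.IsResidual) {M : Type u} [AddCommGroup M] [Module R M]
    (L : Submodule R M) : c.cl L = L ↔ c.cl (⊥ : Submodule R (M ⧸ L)) = ⊥ := by
  have h := hres M L L le_rfl
  rw [Submodule.mkQ_map_self] at h
  rw [h]
  constructor
  · intro h
    rw [← Submodule.map_comap_eq_of_surjective L.mkQ_surjective (c.cl ⊥), h,
      Submodule.mkQ_map_self]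
  · intro h
    rw [h, Submodule.comap_bot, Submodule.ker_mkQ]

end Closure

/-! ### The cogenerator property and cl-rationality. -/

section Hull

variable {R : Type u} [CommRing R] [IsLocalRing R]

/-- The injective hull of the residue field is a cogenerator. -/
lemma IsInjectiveHull.exists_apply_ne_zero {E : Type u} [AddCommGroup E] [Module R E]
    {ι : ResidueField R →ₗ[R] E} (hE : IsInjectiveHull ι) {M : Type u} [AddCommGroup M] [Module R M]
    {m : M} (hm : m ≠ 0) : ∃ f : M →ₗ[R] E, f m ≠ 0 := by
  have := hE.injective_module
  -- Since m ≠ 0, its annihilator is proper, so Rm maps onto the residue field with m going to 1;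
  -- injectivity of E extends the resulting map to M.
  have hle : Ideal.torsionOf R M m ≤
      LinearMap.ker (ι ∘ₗ (Algebra.linearMap R (ResidueField R))) := by
    intro r hr
    have hrm : r ∈ maximalIdeal R := by
      refine IsLocalRing.le_maximalIdeal ?_ hr
      rw [Ideal.ne_top_iff_one, Ideal.mem_torsionOf_iff, one_smul]
      exact hm
    have : algebraMap R (ResidueField R) r = 0 := (residue_eq_zero_iff r).2 hrm
    change ι (algebraMap R (ResidueField R) r) = 0
    rw [this, map_zero]
  let g : Submodule.span R {m} →ₗ[R] E := (Submodule.liftQ _ _ hle) ∘ₗ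
    (Ideal.quotTorsionOfEquivSpanSingleton R M m).symm.toLinearMap
  obtain ⟨f, hf⟩ := Module.Injective.out (Submodule.span R {m}).subtype
    (Submodule.subtype_injective _) g
  refine ⟨f, ?_⟩
  have h1 := hf ⟨m, Submodule.mem_span_singleton_self m⟩
  have h2 : (Ideal.quotTorsionOfEquivSpanSingleton R M m).symm
      ⟨m, Submodule.mem_span_singleton_self m⟩ = Submodule.Quotient.mk 1 := by
    rw [LinearEquiv.symm_apply_eq]
    refine Subtype.ext ?_
    rw [Ideal.quotTorsionOfEquivSpanSingleton_apply_mk]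
    simp
  simp only [Submodule.subtype_apply] at h1
  rw [h1]
  simp only [g, LinearMap.comp_apply, LinearEquiv.coe_coe, h2]
  rw [Submodule.liftQ_apply]
  simpa using hE.injective_map.ne (one_ne_zero (α := ResidueField R))

/-- A nonzero element of 0^cl would be detected by some functional on ω^∨, which then lies outside
the annihilator. -/
lemma isClRational_iff {d : ℕ} {E ω : Type u} [AddCommGroup E] [Module R E] [AddCommGroup ω]
    [Module R ω] {ι : ResidueField R →ₗ[R] E} (hE : IsInjectiveHull ι) (c : ClosureOperation R)
    (φ : MatlisDual R E ω ≃ₗ[R] LocalCohomologyRing R d) :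
    IsClRational c φ ↔ c.cl (⊥ : Submodule R (LocalCohomologyRing R d)) = ⊥ := by
  rw [IsClRational, eq_top_iff]
  constructor
  · intro h
    rw [eq_bot_iff]
    intro z hz
    by_contra hz0
    obtain ⟨f, hf⟩ := hE.exists_apply_ne_zero (m := φ.symm z)
      (by simpa using hz0)
    exact hf (h (x := f) trivial _ ⟨z, hz, rfl⟩)
  · rintro h f -
    rintro - ⟨z, hz, rfl⟩
    rw [h] at hz
    obtain rfl : z = 0 := hz
    simp

end Hull

end ClRationality

end

/-- The canonical module `ω` of the complete local ring `R` of dimension `d` is a finitely generated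
module with an isomorphism `φ` from its Matlis dual `Hom_R(ω, E)` onto `H^d_m(R)`, where `E` is the
injective hull of the residue field. -/
theorem mainTheorem5 {R : Type u} [CommRing R] [IsLocalRing R] [IsNoetherianRing R]
    [IsAdicComplete (IsLocalRing.maximalIdeal R) R]
    (hCM : ClRationality.IsCohenMacaulayLocal R)
    (d : ℕ) (hd : ringKrullDim R = (d : WithBot ℕ∞))
    {E : Type u} [AddCommGroup E] [Module R E]
    (ι : IsLocalRing.ResidueField R →ₗ[R] E) (hE : ClRationality.IsInjectiveHull ι)
    {ω : Type u} [AddCommGroup ω] [Module R ω] [Module.Finite R ω]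
    (φ : ClRationality.MatlisDual R E ω ≃ₗ[R] ClRationality.LocalCohomologyRing R d)
    (c : ClRationality.ClosureOperation R) (hres : c.IsResidual) (hfun : c.IsFunctorial) :
    (ClRationality.IsClRational c φ → ClRationality.ParameterIdealsClosed c) ∧
      (ClRationality.InjectiveFiniteness c d →
        ClRationality.ParameterIdealsClosed c → ClRationality.IsClRational c φ) := by
  rw [ClRationality.isClRational_iff hE]
  constructor
  · intro h n x hx
    obtain rfl : n = d := by exact_mod_cast hx.1.symm.trans hd
    obtain ⟨f, hf⟩ := hx.exists_embedding hCM
    exact (ClRationality.cl_eq_self_iff hres _).2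
      (ClRationality.cl_bot_eq_bot_of_injective hfun f hf h)
  · intro hfin h
    rw [eq_bot_iff]
    intro z hz
    have hz' : z ∈ c.clFg (⊥ : Submodule R (ClRationality.LocalCohomologyRing R d)) := hfin ▸ hz
    simp only [ClRationality.ClosureOperation.clFg, Set.mem_iUnion] at hz'
    obtain ⟨N, hle, hN, hzN⟩ := hz'
    -- The finitistic closure asks that N / 0 be finitely generated, which means that N itself is.
    have hbot : (⊥ : Submodule R (ClRationality.LocalCohomologyRing R d)).submoduleOf N = ⊥ := by
      simp [Submodule.submoduleOf]
    have hfg : N.FG := by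
      rw [← Module.Finite.iff_fg]
      rw [hbot] at hN
      exact Module.Finite.equiv (Submodule.quotEquivOfEqBot (⊥ : Submodule R N) rfl)
    obtain ⟨x, hx, f, hf⟩ := ClRationality.exists_embedding_of_fg hCM hd N hfg
    have h0 := ClRationality.cl_bot_eq_bot_of_injective hfun f hf
      ((ClRationality.cl_eq_self_iff hres _).1 (h d x hx))
    rw [hbot, h0] at hzN
    simpa using hzN
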